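/- **Model.** There are $N$ parallel FCFS servers and $d$ replicas per job, $2\le d\le N$. Jobs arrive according to a Poisson process of rate $\lambda>0$. The $d$ replicas of each arriving job are assigned to $d$ servers chosen uniformly at random without replacement; as soon as one replica completes, the others are abandoned (cancel-on-completion, c.o.c.). The replicas have i.i.d. service requirements, independent of everything else. If the workload vector just before an arrival is $\omega\in[0,\infty)^N$ (where the workload $\omega_i$ is the time server $i$ needs to become idle in the absence of arrivals), and the job samples servers $s_1,\dots,s_d$ with service requirements $b_1,\dots,b_d$, then the workload of each sampled server $s_l$ becomes $\max\{\min_j(\omega_{s_j}+b_j),\,\omega_{s_l}\}$ and the other workloads do not change; between arrivals every positive workload decreases at unit rate. The system is called *stable* if this workload process has a stationary probability distribution on $[0,\infty)^N$. The service requirements are *scaled Bernoulli* with scale $K\ge 1$: they equal $X\cdot K$ with probability $1/K$ and $0$ with probability $1-1/K$, where $X$ is a strictly positive random variable with $\mathbb{E}[X]=1$. Let $X_1,\dots,X_d$ be i.i.d. copies of $X$. **Theorem.** For every $N\ge d\ge 2$ and every $\epsilon>0$ there exists $K_\epsilon(d,N)\ge 1$, depending only on $\epsilon,d,N$ (and neither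 on $\lambda$ nor on the law of $X$), such that for all $K>K_\epsilon(d,N)$, all laws of $X$ as above and all $\lambda>0$: if the c.o.c. system with scaled Bernoulli service requirements is stable, then $$(1-\epsilon)\,\frac{\lambda\,\mathbb{E}[\min\{X_1,\dots,X_d\}]}{K^{d-1}}<1 .$$ -/

import Mathlib

open MeasureTheory ProbabilityTheory

namespace COCRedundancy

noncomputable section

/-- The workload vector of `N` servers: `w i` is the workload at server `i`. -/
abbrev Workload (N : ℕ) : Type := Fin N → ℝ

/-- The data `(T, s, b)` of one job: the time `T` between the previous arrival (or time `0`) and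
the arrival of this job, the sampled servers `s 0, …, s (d - 1)`, and the service requirements
`b 0, …, b (d - 1)` of the replicas at these servers. -/
abbrev Job (N d : ℕ) : Type := ℝ × (Fin d → Fin N) × (Fin d → ℝ)

/-- Without arrivals each server works at unit speed until it is idle. -/
def drain {N : ℕ} (w : Workload N) (t : ℝ) : Workload N :=
  fun i => max (w i - t) 0

/-- The time until a job that is assigned now is completed, `min_j (w_{s_j} + b_j)`. -/
def completionTime {N d : ℕ} (w : Workload N) (s : Fin d → Fin N) (b : Fin d → ℝ) : ℝ :=
  ⨅ j, (w (s j) + b j)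

open Classical in
/-- The workloads just after a job has been assigned under cancel-on-completion: every sampled
server is busy until the job is completed, or until its earlier work is finished if that is later;
the other servers are not affected. -/
def assign {N d : ℕ} (w : Workload N) (s : Fin d → Fin N) (b : Fin d → ℝ) : Workload N :=
  fun i => if ∃ j, s j = i then max (completionTime w s b) (w i) else w i

/-- The workloads just after the `n`-th arrival (the initial workloads if `n = 0`). -/
def afterArrival {N d : ℕ} (w : Workload N) (jobs : ℕ → Job N d) : ℕ → Workload N
  | 0 => w
  | n + 1 => assign (drain (afterArrival w jobs n) (jobs n).1) (jobs n).2.1 (jobs n).2.2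

/-- The time of the `n`-th arrival (`0` if `n = 0`). -/
def arrivalTime {N d : ℕ} (jobs : ℕ → Job N d) (n : ℕ) : ℝ :=
  ∑ k ∈ Finset.range n, (jobs k).1

/-- The number of arrivals in the time interval `[0, t]`. -/
def numArrivals {N d : ℕ} (jobs : ℕ → Job N d) (t : ℝ) : ℕ :=
  {n : ℕ | arrivalTime jobs (n + 1) ≤ t}.ncard

/-- The workload vector `ω(t)` at time `t`, for the initial workloads `w`. -/
def workload {N d : ℕ} (w : Workload N) (jobs : ℕ → Job N d) (t : ℝ) : Workload N :=
  drain (afterArrival w jobs (numArrivals jobs t)) (t - arrivalTime jobs (numArrivals jobs t))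

/-- The scaled Bernoulli law: `X * K` with probability `1 / K`, where `X` has law `ν`,
and `0` with probability `1 - 1 / K`. -/
def scaledBernoulli (ν : Measure ℝ) (K : ℝ) : Measure ℝ :=
  ENNReal.ofReal (1 / K) • ν.map (fun x => x * K) + ENNReal.ofReal (1 - 1 / K) • Measure.dirac 0

/-- The law of one job: the interarrival time is exponential with rate `lam`, the `d` servers are
chosen uniformly at random without replacement, the service requirements are i.i.d. with law `β`,
and these three are independent. -/
def jobLaw (N d : ℕ) (lam : ℝ) (β : Measure ℝ) : Measure (Job N d) :=
  (expMeasure lam).prod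
    ((uniformOn {s : Fin d → Fin N | Function.Injective s}).prod (Measure.pi fun _ => β))

/-- The law of the sequence of jobs, which are i.i.d.; in particular the arrivals form a Poisson
process with rate `lam`. -/
def jobsLaw (N d : ℕ) (lam : ℝ) (β : Measure ℝ) : Measure (ℕ → Job N d) :=
  Measure.infinitePi fun _ => jobLaw N d lam β

/-- The law of `ω(t)` if the initial workload vector has law `π` and is independent of the jobs. -/
def workloadLaw {N : ℕ} (d : ℕ) (lam : ℝ) (β : Measure ℝ) (π : Measure (Workload N)) (t : ℝ) :
    Measure (Workload N) :=
  (π.prod (jobsLaw N d lam β)).map fun p => workload p.1 p.2 t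

/-- The system with `N` servers, `d` replicas per job, arrival rate `lam` and i.i.d. service
requirements with law `β` is stable: its workload process has a stationary distribution, that is,
a probability measure on `[0, ∞)^N` that is invariant under the evolution of the workloads. -/
def Stable (N d : ℕ) (lam : ℝ) (β : Measure ℝ) : Prop :=
  ∃ π : Measure (Workload N), IsProbabilityMeasure π ∧ (∀ᵐ w ∂π, ∀ i, 0 ≤ w i) ∧
    ∀ t : ℝ, 0 ≤ t → workloadLaw d lam β π t = π

/-- `E[min {X_1, …, X_d}]` for i.i.d. random variables `X_1, …, X_d` with law `ν`. -/
def expectedMin (d : ℕ) (ν : Measure ℝ) : ℝ :=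
  ∫ x : Fin d → ℝ, ⨅ j, x j ∂(Measure.pi fun _ => ν)

end

end COCRedundancy

/-! The smallest workload is shown to have positive drift when the load is too large. Dropping all
service and clamping requirements to `[0, c]` gives the process `growth`. The true workloads
dominate it up to the elapsed time (`growth_le_afterArrival`), so it suffices that the least load of
`growth` increases per arrival by more than the mean interarrival time `1 / lam`.

Let all workloads be at least `v`. A job whose requirements have minimum `y > 0` lifts its `d`
servers to `v + y`. After that, a job that samples a lifted server and an unlifted one lifts the
latter as well, and it needs only `d - 1` requirements of size at least `y`. For scaled Bernoulli
requirements the first kind of job has probability of order `K ^ (-d)`, the second of order `K ^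
(-(d - 1))`. The lifting phase therefore costs only a fraction of order `1 / K` of the arrivals, and
the least load gains almost the full mean minimum per arrival.

`GrowthBound` makes this quantitative by induction on the number of arrivals. The expected cost of
lifting is controlled uniformly in the law by `lintegral_invTail_le`: the reciprocal of a tail
probability is integrated against the law of the minimum, and the tails cancel. A stationary law
excludes positive drift even when the least load has no mean (`integral_le_zero_of_stationary`),
which yields `not_stable_of_growth_rate`. -/

namespace COCRedundancy

noncomputable section

/-! ### Pathwise comparison of the workloads with the process without service. -/

section Deterministic

variable {N d : ℕ}

/-- The projection of `x` to the interval `[0, c]`. -/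
def clamp (c x : ℝ) : ℝ := min (max x 0) c

/-- The workloads just after the `n`-th arrival if the servers never work and the service
requirements are clamped to `[0, c]`. -/
def growth (c : ℝ) (w : Workload N) (jobs : ℕ → Job N d) : ℕ → Workload N
  | 0 => w
  | n + 1 => assign (growth c w jobs n) (jobs n).2.1 fun j => clamp c ((jobs n).2.2 j)

/-- The smallest workload. -/
def leastLoad (w : Workload N) : ℝ := ⨅ i, w i

lemma clamp_nonneg {c : ℝ} (hc : 0 ≤ c) (x : ℝ) : 0 ≤ clamp c x :=
  le_min (le_max_right _ _) hc

lemma clamp_le (c x : ℝ) : clamp c x ≤ c := min_le_right _ _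

lemma clamp_le_self {c x : ℝ} (hx : 0 ≤ x) : clamp c x ≤ x := by
  unfold clamp; rw [max_eq_left hx]; exact min_le_left _ _

lemma le_clamp {c x y : ℝ} (hyc : y ≤ c) (hy : y ≤ x) : y ≤ clamp c x :=
  le_min (hy.trans (le_max_left _ _)) hyc

@[fun_prop]
lemma measurable_clamp (c : ℝ) : Measurable (clamp c) := by
  unfold clamp; fun_prop

lemma leastLoad_le (w : Workload N) (i : Fin N) : leastLoad w ≤ w i :=
  ciInf_le (Set.finite_range w).bddBelow i

lemma le_leastLoad [Nonempty (Fin N)] {w : Workload N} {x : ℝ} (h : ∀ i, x ≤ w i) :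
    x ≤ leastLoad w :=
  le_ciInf h

@[fun_prop]
lemma measurable_leastLoad : Measurable (leastLoad : Workload N → ℝ) := by
  unfold leastLoad
  exact Measurable.iInf fun i => measurable_pi_apply i

lemma completionTime_le (w : Workload N) (s : Fin d → Fin N) (b : Fin d → ℝ) (j : Fin d) :
    completionTime w s b ≤ w (s j) + b j :=
  ciInf_le (f := fun j => w (s j) + b j) (Set.finite_range _).bddBelow j

lemma completionTime_mono [Nonempty (Fin d)] {w w' : Workload N} (hw : ∀ i, w i ≤ w' i)
    (s : Fin d → Fin N) {b b' : Fin d → ℝ} (hb : ∀ j, b j ≤ b' j) :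
    completionTime w s b ≤ completionTime w' s b' :=
  le_ciInf fun j => (completionTime_le w s b j).trans (add_le_add (hw _) (hb j))

lemma assign_mono [Nonempty (Fin d)] {w w' : Workload N} (hw : ∀ i, w i ≤ w' i)
    (s : Fin d → Fin N) {b b' : Fin d → ℝ} (hb : ∀ j, b j ≤ b' j) (i : Fin N) :
    assign w s b i ≤ assign w' s b' i := by
  unfold assign
  split_ifs
  · exact max_le_max (completionTime_mono hw s hb) (hw i)
  · exact hw i

lemma le_assign (w : Workload N) (s : Fin d → Fin N) (b : Fin d → ℝ) (i : Fin N) :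
    w i ≤ assign w s b i := by
  unfold assign
  split_ifs
  · exact le_max_right _ _
  · exact le_rfl

lemma assign_le {w : Workload N} {x c : ℝ} (hc : 0 ≤ c) (hw : ∀ i, w i ≤ x)
    (s : Fin d → Fin N) {b : Fin d → ℝ} (hb : ∀ j, b j ≤ c) (i : Fin N) :
    assign w s b i ≤ x + c := by
  unfold assign
  split_ifs with h
  · obtain ⟨j, -⟩ := h
    exact max_le ((completionTime_le w s b j).trans (add_le_add (hw _) (hb j)))
      ((hw i).trans (by linarith))
  · exact (hw i).trans (by linarith)

lemma le_assign_of_mem [Nonempty (Fin d)] {w : Workload N} {s : Fin d → Fin N} {b : Fin d → ℝ}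
    {x : ℝ} (h : ∀ j, x ≤ w (s j) + b j) (j : Fin d) : x ≤ assign w s b (s j) := by
  unfold assign
  rw [if_pos ⟨j, rfl⟩]
  exact le_max_of_le_left (le_ciInf h)

lemma assign_add_const [Nonempty (Fin d)] (w : Workload N) (s : Fin d → Fin N) (b : Fin d → ℝ)
    (a : ℝ) (i : Fin N) : assign w s b i + a ≤ assign (fun i => w i + a) s b i := by
  unfold assign
  split_ifs
  · rw [max_add]
    refine max_le_max (le_ciInf fun j => ?_) le_rfl
    linarith [completionTime_le w s b j]
  · exact le_rfl

/-- The definition splits off the last job; splitting off the first one is what the Markov recursion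
`meanGrowth_succ` needs. -/
lemma growth_succ' (c : ℝ) (w : Workload N) (jobs : ℕ → Job N d) (n : ℕ) :
    growth c w jobs (n + 1) =
      growth c (assign w (jobs 0).2.1 fun j => clamp c ((jobs 0).2.2 j))
        (fun k => jobs (k + 1)) n := by
  induction n with
  | zero => rfl
  | succ n ih => rw [growth, ih]; rfl

lemma growth_mono (c : ℝ) (w : Workload N) (jobs : ℕ → Job N d) {n n' : ℕ} (h : n ≤ n')
    (i : Fin N) : growth c w jobs n i ≤ growth c w jobs n' i := by
  induction n', h using Nat.le_induction with
  | base => exact le_rfl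
  | succ n' _ ih => exact ih.trans (le_assign _ _ _ i)

lemma growth_le {c : ℝ} (hc : 0 ≤ c) (jobs : ℕ → Job N d) (n : ℕ) (i : Fin N) :
    growth c 0 jobs n i ≤ n * c := by
  induction n generalizing i with
  | zero => simp [growth]
  | succ n ih =>
    push_cast
    rw [add_mul, one_mul]
    exact assign_le hc ih _ (fun j => clamp_le _ _) i

/-- `assign` is monotone and dominates translation by a constant, and draining lowers a workload by
at most the elapsed time; idling only helps the lower bound. -/
lemma growth_le_afterArrival [Nonempty (Fin d)] (c : ℝ) {w : Workload N} {x : ℝ}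
    (hw : ∀ i, x ≤ w i) {jobs : ℕ → Job N d} (hb : ∀ n j, 0 ≤ (jobs n).2.2 j) (n : ℕ)
    (i : Fin N) :
    growth c 0 jobs n i + (x - arrivalTime jobs n) ≤ afterArrival w jobs n i := by
  induction n generalizing i with
  | zero => simpa [growth, arrivalTime, afterArrival] using hw i
  | succ n ih =>
    refine (assign_add_const _ _ _ _ i).trans (assign_mono (fun i => ?_) _ (fun j => ?_) i)
    · refine le_max_of_le_left ?_
      have := ih i
      rw [arrivalTime, Finset.sum_range_succ]
      rw [arrivalTime] at this
      linarith
    · exact clamp_le_self (hb n j)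

lemma arrivalTime_mono {jobs : ℕ → Job N d} (hT : ∀ n, 0 ≤ (jobs n).1) :
    Monotone (arrivalTime jobs) :=
  monotone_nat_of_le_succ fun n => by
    rw [arrivalTime, arrivalTime, Finset.sum_range_succ]
    linarith [hT n]

lemma le_numArrivals {jobs : ℕ → Job N d} (hT : ∀ n, 0 ≤ (jobs n).1) {t : ℝ}
    (hfin : {n : ℕ | arrivalTime jobs (n + 1) ≤ t}.Finite) {n : ℕ}
    (hn : arrivalTime jobs n ≤ t) : n ≤ numArrivals jobs t := by
  have hsub : (Finset.range n : Set ℕ) ⊆ {n : ℕ | arrivalTime jobs (n + 1) ≤ t} := by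
    intro k hk
    exact (arrivalTime_mono hT (by simpa using hk)).trans hn
  -- Finiteness is essential: `ncard` of an infinite set is `0`.
  have := Set.ncard_le_ncard hsub hfin
  rwa [Set.ncard_coe_finset, Finset.card_range] at this

/-- The random number of arrivals is replaced by a fixed `n`. If fewer than `n` jobs have arrived by
time `t`, the correction `n * c` exceeds all that `growth` can reach in `n` steps. The increment no
longer depends on `w`. -/
lemma leastLoad_workload_ge [Nonempty (Fin d)] [Nonempty (Fin N)] {c : ℝ} (hc : 0 ≤ c)
    (w : Workload N) {jobs : ℕ → Job N d} (hT : ∀ n, 0 ≤ (jobs n).1)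
    (hb : ∀ n j, 0 ≤ (jobs n).2.2 j) {t : ℝ}
    (hfin : {n : ℕ | arrivalTime jobs (n + 1) ≤ t}.Finite) (n : ℕ) :
    leastLoad w + (leastLoad (growth c 0 jobs n) -
      {jobs : ℕ → Job N d | t < arrivalTime jobs n}.indicator (fun _ => n * c) jobs - t) ≤
        leastLoad (workload w jobs t) := by
  refine le_leastLoad fun i => le_max_of_le_left ?_
  have h1 := growth_le_afterArrival c (leastLoad_le w) hb (numArrivals jobs t) i
  have h2 := leastLoad_le (growth c 0 jobs n) i
  by_cases h : t < arrivalTime jobs n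
  · rw [Set.indicator_of_mem (by exact h)]
    have h3 := growth_le hc jobs n i
    have h4 : 0 ≤ growth c 0 jobs (numArrivals jobs t) i :=
      growth_mono c 0 jobs (Nat.zero_le _) i
    linarith
  · rw [Set.indicator_of_notMem (by exact h)]
    have h3 := growth_mono c 0 jobs (le_numArrivals hT hfin (not_lt.1 h)) i
    linarith

lemma measurable_assign [Nonempty (Fin d)] :
    Measurable fun p : Workload N × (Fin d → Fin N) × (Fin d → ℝ) => assign p.1 p.2.1 p.2.2 := by
  have key : Measurable fun p : (Workload N × (Fin d → ℝ)) × (Fin d → Fin N) =>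
      assign p.1.1 p.2 p.1.2 := by
    refine measurable_from_prod_countable_left fun s => ?_
    refine measurable_pi_lambda _ fun i => ?_
    have hc : Measurable fun p : Workload N × (Fin d → ℝ) => completionTime p.1 s p.2 := by
      unfold completionTime
      exact Measurable.iInf fun j => by fun_prop
    by_cases h : ∃ j, s j = i
    · simp only [assign, h, if_true]
      exact hc.max (by fun_prop)
    · simp only [assign, h, if_false]
      fun_prop
  have hp : Measurable fun p : Workload N × (Fin d → Fin N) × (Fin d → ℝ) =>
      ((p.1, p.2.2), p.2.1) := by fun_prop
  exact key.comp hp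

lemma measurable_growth [Nonempty (Fin d)] (c : ℝ) (n : ℕ) :
    Measurable fun p : Workload N × (ℕ → Job N d) => growth c p.1 p.2 n := by
  induction n with
  | zero => exact measurable_fst
  | succ n ih =>
    have hp : Measurable fun p : Workload N × (ℕ → Job N d) =>
        (growth c p.1 p.2 n, (p.2 n).2.1, fun j => clamp c ((p.2 n).2.2 j)) := by fun_prop
    exact measurable_assign.comp hp

end Deterministic

/-! ### Shifts of i.i.d. sequences and the integral of inverse tails. -/

section MeasureTools

open scoped ENNReal

lemma map_cons_infinitePi {α : Type*} [MeasurableSpace α] (μ : Measure α)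
    [IsProbabilityMeasure μ] :
    (μ.prod (Measure.infinitePi fun _ : ℕ => μ)).map
      (fun p n => Nat.casesOn n p.1 p.2 : α × (ℕ → α) → ℕ → α) =
        Measure.infinitePi fun _ : ℕ => μ := by
  have hmeas : Measurable (fun p n => Nat.casesOn n p.1 p.2 : α × (ℕ → α) → ℕ → α) := by
    refine measurable_pi_lambda _ fun n => ?_
    cases n with
    | zero => exact measurable_fst
    | succ n => exact (measurable_pi_apply n).comp measurable_snd
  refine Measure.eq_infinitePi _ fun s t ht => ?_
  rw [Measure.map_apply hmeas (.pi s.countable_toSet fun i _ => ht i)]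
  have hpre : (fun p n => Nat.casesOn n p.1 p.2 : α × (ℕ → α) → ℕ → α) ⁻¹' (s : Set ℕ).pi t =
      (if 0 ∈ s then t 0 else Set.univ) ×ˢ
        ((s.preimage Nat.succ (Nat.succ_injective.injOn) : Finset ℕ) : Set ℕ).pi
          fun n => t (n + 1) := by
    ext ⟨x, y⟩
    constructor
    · intro h
      refine ⟨?_, fun n hn => h (n + 1) (by simpa using hn)⟩
      split_ifs with h0
      · exact h 0 h0
      · trivial
    · rintro ⟨h0, h1⟩ n hn
      cases n with
      | zero => rwa [if_pos (by exact hn)] at h0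
      | succ n => exact h1 n (by simpa using hn)
  classical
  rw [hpre, Measure.prod_prod, Measure.infinitePi_pi _ (fun i _ => ht _),
    Finset.prod_preimage' Nat.succ s Nat.succ_injective.injOn fun n => μ (t n)]
  have hfil : s.filter (· ∈ Set.range Nat.succ) = s.erase 0 := by
    ext n
    cases n <;> simp
  rw [hfil]
  split_ifs with h0
  · exact Finset.mul_prod_erase s (fun n => μ (t n)) h0
  · rw [measure_univ, one_mul, Finset.erase_eq_of_notMem h0]

lemma lintegral_infinitePi_cons {α : Type*} [MeasurableSpace α] (μ : Measure α)
    [IsProbabilityMeasure μ] {f : (ℕ → α) → ℝ≥0∞} (hf : Measurable f) :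
    ∫⁻ x, f x ∂Measure.infinitePi (fun _ : ℕ => μ) =
      ∫⁻ a, ∫⁻ x, f (fun n => Nat.casesOn n a x) ∂Measure.infinitePi (fun _ : ℕ => μ) ∂μ := by
  have hmeas : Measurable (fun p n => Nat.casesOn n p.1 p.2 : α × (ℕ → α) → ℕ → α) := by
    refine measurable_pi_lambda _ fun n => ?_
    cases n with
    | zero => exact measurable_fst
    | succ n => exact (measurable_pi_apply n).comp measurable_snd
  conv_lhs => rw [← map_cons_infinitePi]
  rw [lintegral_map hf hmeas]
  exact lintegral_prod _ (hf.comp hmeas).aemeasurable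

lemma measurable_measure_Ici (β : Measure ℝ) : Measurable fun x => β (Set.Ici x) :=
  Antitone.measurable fun _ _ h => measure_mono (Set.Ici_subset_Ici.2 h)

/-- Given `b j = x`, the other `m` coordinates are at least `x` with probability exactly `β (Ici x)
^ m`, which cancels the integrand. Only the event `0 < x` remains. -/
lemma lintegral_inv_tail_le {m : ℕ} (β : Measure ℝ) [IsProbabilityMeasure β] (j : Fin (m + 1)) :
    ∫⁻ b, {b : Fin (m + 1) → ℝ | 0 < b j ∧ ∀ i, b j ≤ b i}.indicator
      (fun b => (β (Set.Ici (b j)) ^ m)⁻¹) b ∂Measure.pi (fun _ => β) ≤ β (Set.Ioi 0) := by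
  set f : ℝ × (Fin m → ℝ) → ℝ≥0∞ := fun p =>
    {p : ℝ × (Fin m → ℝ) | 0 < p.1 ∧ ∀ i, p.1 ≤ p.2 i}.indicator
      (fun p => (β (Set.Ici p.1) ^ m)⁻¹) p with hf
  have hset : MeasurableSet {p : ℝ × (Fin m → ℝ) | 0 < p.1 ∧ ∀ i, p.1 ≤ p.2 i} := by
    measurability
  have hfm : Measurable f :=
    Measurable.indicator ((((measurable_measure_Ici β).comp measurable_fst).pow_const m).inv) hset
  have hmp := measurePreserving_piFinSuccAbove (fun _ : Fin (m + 1) => β) j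
  have h1 : ∀ b : Fin (m + 1) → ℝ, {b : Fin (m + 1) → ℝ | 0 < b j ∧ ∀ i, b j ≤ b i}.indicator
      (fun b => (β (Set.Ici (b j)) ^ m)⁻¹) b ≤
        f (MeasurableEquiv.piFinSuccAbove (fun _ => ℝ) j b) := by
    intro b
    rw [Set.indicator_apply]
    split_ifs with hb
    swap
    · exact zero_le
    have hb' : MeasurableEquiv.piFinSuccAbove (fun _ => ℝ) j b ∈
        {p : ℝ × (Fin m → ℝ) | 0 < p.1 ∧ ∀ i, p.1 ≤ p.2 i} := ⟨hb.1, fun i => hb.2 _⟩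
    rw [hf]
    simp only [Set.indicator_of_mem hb']
    exact le_rfl
  refine (lintegral_mono h1).trans ?_
  rw [hmp.lintegral_comp hfm, lintegral_prod _ hfm.aemeasurable,
    ← lintegral_indicator_one measurableSet_Ioi]
  refine lintegral_mono fun x => ?_
  by_cases hx : 0 < x
  · have h2 : ∀ y : Fin m → ℝ, f (x, y) =
        (Set.univ.pi fun _ => Set.Ici x).indicator (fun _ => (β (Set.Ici x) ^ m)⁻¹) y := by
      intro y
      by_cases hy : ∀ i, x ≤ y i
      · rw [hf, Set.indicator_of_mem (by exact fun i _ => hy i)]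
        exact Set.indicator_of_mem (by exact ⟨hx, hy⟩) _
      · have hy' : y ∉ Set.univ.pi fun _ : Fin m => Set.Ici x := fun h =>
          hy fun i => h i trivial
        rw [hf, Set.indicator_of_notMem hy']
        exact Set.indicator_of_notMem (fun h => hy h.2) _
    simp_rw [h2]
    rw [lintegral_indicator_const (.univ_pi fun _ => measurableSet_Ici), Measure.pi_pi,
      Set.indicator_of_mem (by exact hx)]
    simp only [Finset.prod_const, Finset.card_univ, Fintype.card_fin, Pi.one_apply]
    rw [mul_comm]
    -- An inequality suffices, so a vanishing tail needs no separate case.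
    exact ENNReal.mul_inv_le_one _
  · have h2 : ∀ y : Fin m → ℝ, f (x, y) = 0 := fun y =>
      Set.indicator_of_notMem (fun h => hx h.1) _
    simp [h2]

/-- The smallest clamped service requirement of a job. -/
def minClamp {d : ℕ} (c : ℝ) (b : Fin d → ℝ) : ℝ := ⨅ j, clamp c (b j)

lemma minClamp_le {d : ℕ} (c : ℝ) (b : Fin d → ℝ) (j : Fin d) : minClamp c b ≤ clamp c (b j) :=
  ciInf_le (f := fun j => clamp c (b j)) (Set.finite_range _).bddBelow j

lemma minClamp_nonneg {d : ℕ} [Nonempty (Fin d)] {c : ℝ} (hc : 0 ≤ c) (b : Fin d → ℝ) :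
    0 ≤ minClamp c b := le_ciInf fun _ => clamp_nonneg hc _

@[fun_prop]
lemma measurable_minClamp {d : ℕ} (c : ℝ) : Measurable (minClamp c : (Fin d → ℝ) → ℝ) := by
  unfold minClamp
  exact Measurable.iInf fun j => by fun_prop

/-- The reciprocal of the probability that `d - 1` service requirements are at least `minClamp c b`,
or `0` if `minClamp c b` is not positive. -/
def invTail {d : ℕ} (β : Measure ℝ) (c : ℝ) (b : Fin d → ℝ) : ℝ≥0∞ :=
  {b : Fin d → ℝ | 0 < minClamp c b}.indicator
    (fun b => (β (Set.Ici (minClamp c b)) ^ (d - 1))⁻¹) b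

lemma measurable_invTail {d : ℕ} (β : Measure ℝ) (c : ℝ) :
    Measurable (invTail β c : (Fin d → ℝ) → ℝ≥0∞) :=
  Measurable.indicator (((measurable_measure_Ici β).comp (measurable_minClamp c)).pow_const _).inv
    (measurableSet_lt measurable_const (measurable_minClamp c))

/-- Union bound over the coordinate that attains the minimum, which is where the factor `d` arises;
ties only enlarge the sum. -/
lemma lintegral_invTail_le {d : ℕ} [Nonempty (Fin d)] (β : Measure ℝ) [IsProbabilityMeasure β]
    (c : ℝ) :
    ∫⁻ b : Fin d → ℝ, invTail β c b ∂Measure.pi (fun _ => β) ≤ d * β (Set.Ioi 0) := by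
  obtain _ | m := d
  · exact (IsEmpty.false (Classical.arbitrary (Fin 0))).elim
  have hmin : ∀ b : Fin (m + 1) → ℝ, invTail β c b ≤ ∑ j : Fin (m + 1),
      {b : Fin (m + 1) → ℝ | 0 < b j ∧ ∀ i, b j ≤ b i}.indicator
        (fun b => (β (Set.Ici (b j)) ^ m)⁻¹) b := by
    intro b
    rw [invTail, Set.indicator_apply]
    split_ifs with hb
    swap
    · exact zero_le
    obtain ⟨j, hj⟩ := Finite.exists_min b
    have h0 : 0 < clamp c (b j) := lt_of_lt_of_le hb (minClamp_le c b j)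
    have hbj : 0 < b j := by
      have := lt_of_lt_of_le h0 (min_le_left _ _)
      exact (lt_max_iff.1 this).resolve_right (lt_irrefl _)
    have hle : minClamp c b ≤ b j := (minClamp_le c b j).trans (clamp_le_self hbj.le)
    refine le_trans ?_ (Finset.single_le_sum (fun _ _ => zero_le) (Finset.mem_univ j))
    rw [Set.indicator_of_mem (by exact ⟨hbj, hj⟩)]
    refine ENNReal.inv_le_inv.2 (pow_le_pow_left₀ zero_le ?_ _)
    exact measure_mono (Set.Ici_subset_Ici.2 hle)
  refine (lintegral_mono hmin).trans ?_
  rw [lintegral_finsetSum]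
  · refine (Finset.sum_le_sum fun j _ => lintegral_inv_tail_le β j).trans ?_
    simp
  · intro j _
    exact Measurable.indicator
      (((measurable_measure_Ici β).comp (measurable_pi_apply j)).pow_const m).inv
      (by measurability)

end MeasureTools

/-! ### Probability of a job that lifts a further server. -/

section JobLaw

open scoped ENNReal

variable {N d : ℕ}

lemma isProbabilityMeasure_uniformOn_injective (hdN : d ≤ N) :
    IsProbabilityMeasure (uniformOn {s : Fin d → Fin N | Function.Injective s}) :=
  isProbabilityMeasure_uniformOn (Set.toFinite _) ⟨Fin.castLE hdN, Fin.castLE_injective hdN⟩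

lemma uniformOn_injective_singleton {s : Fin d → Fin N} (hs : Function.Injective s) :
    ((N : ℝ≥0∞) ^ d)⁻¹ ≤ uniformOn {s : Fin d → Fin N | Function.Injective s} {s} := by
  have hne : ({s : Fin d → Fin N | Function.Injective s} ∩ {s}) = {s} := by
    ext t; constructor
    · exact fun h => h.2
    · rintro rfl; exact ⟨hs, rfl⟩
  rw [uniformOn, cond_apply (Set.toFinite _).measurableSet, hne, Measure.count_singleton, mul_one]
  refine ENNReal.inv_le_inv.2 ((measure_mono (Set.subset_univ _)).trans ?_)
  rw [Measure.count_univ]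
  simp

lemma isProbabilityMeasure_jobLaw (hdN : d ≤ N) {lam : ℝ} (hlam : 0 < lam) (β : Measure ℝ)
    [IsProbabilityMeasure β] : IsProbabilityMeasure (jobLaw N d lam β) := by
  have := isProbabilityMeasure_expMeasure hlam
  have := isProbabilityMeasure_uniformOn_injective hdN
  unfold jobLaw
  infer_instance

lemma lintegral_jobLaw_requirements (hdN : d ≤ N) {lam : ℝ} (hlam : 0 < lam) (β : Measure ℝ)
    [IsProbabilityMeasure β] {f : (Fin d → ℝ) → ℝ≥0∞} (hf : Measurable f) :
    ∫⁻ x, f x.2.2 ∂jobLaw N d lam β = ∫⁻ b, f b ∂Measure.pi fun _ => β := by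
  have := isProbabilityMeasure_expMeasure hlam
  have := isProbabilityMeasure_uniformOn_injective hdN
  unfold jobLaw
  rw [lintegral_prod _ (by fun_prop)]
  simp only [lintegral_const, measure_univ, mul_one]
  rw [lintegral_prod _ (by fun_prop)]
  simp

/-- The jobs that sample exactly the servers `s` (in this order) and whose service requirements
are at least `y` except possibly at the server `s j₀`. -/
def liftingJobs (s : Fin d → Fin N) (j₀ : Fin d) (y : ℝ) : Set (Job N d) :=
  Set.univ ×ˢ ({s} ×ˢ Set.univ.pi fun j => if j = j₀ then Set.univ else Set.Ici y)

lemma measurableSet_liftingJobs (s : Fin d → Fin N) (j₀ : Fin d) (y : ℝ) :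
    MeasurableSet (liftingJobs s j₀ y) := by
  refine .prod .univ (.prod (measurableSet_singleton s) (.univ_pi fun j => ?_))
  split_ifs
  · exact .univ
  · exact measurableSet_Ici

lemma jobLaw_liftingJobs_ge {lam : ℝ} (hdN : d ≤ N) (hlam : 0 < lam) (β : Measure ℝ)
    [IsProbabilityMeasure β] {s : Fin d → Fin N} (hs : Function.Injective s) (j₀ : Fin d) (y : ℝ) :
    ((N : ℝ≥0∞) ^ d)⁻¹ * β (Set.Ici y) ^ (d - 1) ≤ jobLaw N d lam β (liftingJobs s j₀ y) := by
  have := isProbabilityMeasure_expMeasure hlam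
  have := isProbabilityMeasure_uniformOn_injective hdN
  unfold jobLaw liftingJobs
  rw [Measure.prod_prod, Measure.prod_prod, measure_univ, one_mul, Measure.pi_pi]
  refine mul_le_mul' (uniformOn_injective_singleton hs) ?_
  rw [← Finset.mul_prod_erase _ _ (Finset.mem_univ j₀)]
  simp only [if_true, measure_univ, one_mul]
  rw [Finset.prod_congr rfl (g := fun _ => β (Set.Ici y))
    fun j hj => by rw [if_neg (Finset.ne_of_mem_erase hj)]]
  simp

end JobLaw

/-! ### Mean growth of the least load without service. -/

section GrowthRate

open scoped ENNReal

variable {N d : ℕ}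

/-- The expectation of the smallest workload after `n` arrivals, if the servers never work, the
service requirements are clamped to `[0, c]`, and the initial workloads are `w`. -/
def meanGrowth (d : ℕ) (lam : ℝ) (β : Measure ℝ) (c : ℝ) (n : ℕ) (w : Workload N) : ℝ≥0∞ :=
  ∫⁻ jobs : ℕ → Job N d, ENNReal.ofReal (leastLoad (growth c w jobs n)) ∂jobsLaw N d lam β

lemma isProbabilityMeasure_jobsLaw (hdN : d ≤ N) {lam : ℝ} (hlam : 0 < lam) (β : Measure ℝ)
    [IsProbabilityMeasure β] : IsProbabilityMeasure (jobsLaw N d lam β) := by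
  have := isProbabilityMeasure_jobLaw hdN hlam β
  unfold jobsLaw
  infer_instance

lemma meanGrowth_zero (hdN : d ≤ N) {lam : ℝ} (hlam : 0 < lam) (β : Measure ℝ)
    [IsProbabilityMeasure β] (c : ℝ) (w : Workload N) :
    meanGrowth d lam β c 0 w = ENNReal.ofReal (leastLoad w) := by
  have := isProbabilityMeasure_jobsLaw hdN hlam β
  simp [meanGrowth, growth]

lemma meanGrowth_succ [Nonempty (Fin d)] (hdN : d ≤ N) {lam : ℝ} (hlam : 0 < lam)
    (β : Measure ℝ) [IsProbabilityMeasure β] (c : ℝ) (n : ℕ) (w : Workload N) :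
    meanGrowth d lam β c (n + 1) w = ∫⁻ x, meanGrowth d lam β c n
      (assign w x.2.1 fun j => clamp c (x.2.2 j)) ∂jobLaw N d lam β := by
  have := isProbabilityMeasure_jobLaw hdN hlam β
  have hm : ∀ n, Measurable fun jobs : ℕ → Job N d => growth c w jobs n := fun n =>
    (measurable_growth c n).comp measurable_prodMk_left
  unfold meanGrowth jobsLaw
  rw [lintegral_infinitePi_cons _ (by fun_prop)]
  simp only [growth_succ']
  rfl

/-- Any injection is corrected by two transpositions; the second one fixes `a`. -/
lemma exists_injective_of_ne (hdN : d ≤ N) {j₀ j₁ : Fin d} (hj : j₀ ≠ j₁) {a b : Fin N}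
    (hab : a ≠ b) : ∃ s : Fin d → Fin N, Function.Injective s ∧ s j₀ = a ∧ s j₁ = b := by
  set e := Fin.castLE hdN with he
  have hinj : Function.Injective e := Fin.castLE_injective hdN
  set σ := Equiv.swap (e j₀) a with hσ
  refine ⟨fun j => Equiv.swap (σ (e j₁)) b (σ (e j)), ?_, ?_, ?_⟩
  · exact (Equiv.injective _).comp ((Equiv.injective _).comp hinj)
  · have h0 : σ (e j₀) = a := Equiv.swap_apply_left _ _
    have h1 : σ (e j₁) ≠ a := fun h => hj (hinj (σ.injective (h0.trans h.symm)))
    simp only [h0]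
    exact Equiv.swap_apply_of_ne_of_ne h1.symm hab
  · exact Equiv.swap_apply_left _ _

/-- The bound for the expected number of arrivals until another server is lifted by `y`. -/
def liftTime (N d : ℕ) (β : Measure ℝ) (y : ℝ) : ℝ≥0∞ :=
  (N : ℝ≥0∞) ^ d * (β (Set.Ici y) ^ (d - 1))⁻¹

/-- A lifting job saves one `liftTime`, so the expected saving per arrival is at least one arrival.
This pays for the induction step of a lifting phase. -/
lemma le_liftTime_mul {lam : ℝ} (hdN : d ≤ N) (hN : 0 < N) (hlam : 0 < lam) (β : Measure ℝ)
    [IsProbabilityMeasure β] {s : Fin d → Fin N} (hs : Function.Injective s) (j₀ : Fin d) {y : ℝ}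
    (hy : liftTime N d β y ≠ ∞) :
    1 ≤ liftTime N d β y * jobLaw N d lam β (liftingJobs s j₀ y) := by
  have hN0 : (N : ℝ≥0∞) ^ d ≠ 0 := pow_ne_zero _ (by exact_mod_cast hN.ne')
  have hNt : (N : ℝ≥0∞) ^ d ≠ ∞ := ENNReal.pow_ne_top (ENNReal.natCast_ne_top N)
  have hH0 : β (Set.Ici y) ^ (d - 1) ≠ 0 := by
    intro h
    apply hy
    rw [liftTime, h, ENNReal.inv_zero, ENNReal.mul_top hN0]
  have hHt : β (Set.Ici y) ^ (d - 1) ≠ ∞ := ENNReal.pow_ne_top (measure_ne_top _ _)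
  refine le_trans (le_of_eq ?_) (mul_le_mul_right (jobLaw_liftingJobs_ge hdN hlam β hs j₀ y) _)
  rw [liftTime, mul_mul_mul_comm, ENNReal.mul_inv_cancel hN0 hNt, one_mul,
    ENNReal.inv_mul_cancel hH0 hHt]

/-- The lower bounds for `meanGrowth`: if all workloads are at least `v`, and if moreover the
workloads in a nonempty set `A` of servers, which lacks at most `r` servers, are at least `v + y`.
-/
def GrowthBound (N d : ℕ) (lam : ℝ) (β : Measure ℝ) (c : ℝ) (g : ℝ≥0∞) (n : ℕ) : Prop :=
  (∀ (w : Workload N) (v : ℝ), 0 ≤ v → (∀ i, v ≤ w i) →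
    ENNReal.ofReal v + g * n ≤ meanGrowth d lam β c n w + ENNReal.ofReal c) ∧
  ∀ (r : ℕ) (w : Workload N) (v y : ℝ) (A : Finset (Fin N)), 0 ≤ v → 0 ≤ y → y ≤ c →
    (∀ i, v ≤ w i) → A.Nonempty → (∀ i ∈ A, v + y ≤ w i) → N ≤ A.card + r →
    ENNReal.ofReal (v + y) + g * n ≤
      meanGrowth d lam β c n w + g * (r * liftTime N d β y) + ENNReal.ofReal c

lemma growthBound_zero [Nonempty (Fin N)] (hdN : d ≤ N) {lam : ℝ} (hlam : 0 < lam)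
    (β : Measure ℝ) [IsProbabilityMeasure β] (c : ℝ) (g : ℝ≥0∞) :
    GrowthBound N d lam β c g 0 := by
  refine ⟨fun w v hv hw => ?_, fun r w v y A hv hy hyc hw _ _ _ => ?_⟩
  · rw [meanGrowth_zero hdN hlam, Nat.cast_zero, mul_zero, add_zero]
    exact le_add_right (ENNReal.ofReal_le_ofReal (le_leastLoad hw))
  · rw [meanGrowth_zero hdN hlam, Nat.cast_zero, mul_zero, add_zero,
      ENNReal.ofReal_add hv hy]
    exact add_le_add (le_add_right (ENNReal.ofReal_le_ofReal (le_leastLoad hw)))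
      (ENNReal.ofReal_le_ofReal hyc)

/-- A job with positive minimum `y` starts a lifting phase with `A` the sampled servers; the number
of missing servers is bounded crudely by `N`. If `y = 0`, no phase starts and `invTail` contributes
no cost. -/
lemma GrowthBound.assign_le [Nonempty (Fin d)] {lam : ℝ} {β : Measure ℝ} {c : ℝ} (hc : 0 ≤ c)
    {g : ℝ≥0∞} {n : ℕ} (h : GrowthBound N d lam β c g n) {w : Workload N} {v : ℝ} (hv : 0 ≤ v)
    (hw : ∀ i, v ≤ w i) (s : Fin d → Fin N) (b : Fin d → ℝ) :
    ENNReal.ofReal v + g * n + ENNReal.ofReal (minClamp c b) ≤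
      meanGrowth d lam β c n (assign w s fun j => clamp c (b j)) +
        g * (N * N ^ d) * invTail β c b + ENNReal.ofReal c := by
  have hw' : ∀ i, v ≤ assign w s (fun j => clamp c (b j)) i := fun i =>
    (hw i).trans (le_assign _ _ _ i)
  rcases (minClamp_nonneg hc b).eq_or_lt with h0 | h0
  · rw [← h0, ENNReal.ofReal_zero, add_zero]
    refine (h.1 _ v hv hw').trans ?_
    gcongr
    exact le_self_add
  · have hle : minClamp c b ≤ c :=
      (minClamp_le c b (Classical.arbitrary _)).trans (clamp_le _ _)
    have := h.2 N (assign w s fun j => clamp c (b j)) v (minClamp c b)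
      (Finset.univ.image s) hv h0.le hle hw'
      (Finset.univ_nonempty.image s) (fun i hi => ?_) (Nat.le_add_left _ _)
    · rw [invTail, Set.indicator_of_mem (by exact h0), add_right_comm,
        ← ENNReal.ofReal_add hv h0.le]
      refine this.trans (le_of_eq ?_)
      rw [liftTime]
      ring
    · obtain ⟨j, -, rfl⟩ := Finset.mem_image.1 hi
      exact le_assign_of_mem (fun j => add_le_add (hw _) (minClamp_le c b j)) j

lemma growthBound_succ_idle [Nonempty (Fin d)] (hdN : d ≤ N) {lam : ℝ}
    (hlam : 0 < lam) (β : Measure ℝ) [IsProbabilityMeasure β] {c : ℝ} (hc : 0 ≤ c) {g : ℝ≥0∞}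
    (hgt : g ≠ ∞)
    (hrate : g * (1 + N * N ^ d * d * β (Set.Ioi 0)) ≤
      ∫⁻ b : Fin d → ℝ, ENNReal.ofReal (minClamp c b) ∂Measure.pi fun _ => β)
    {n : ℕ} (h : GrowthBound N d lam β c g n) (w : Workload N) (v : ℝ) (hv : 0 ≤ v)
    (hw : ∀ i, v ≤ w i) :
    ENNReal.ofReal v + g * (n + 1 : ℕ) ≤
      meanGrowth d lam β c (n + 1) w + ENNReal.ofReal c := by
  have := isProbabilityMeasure_jobLaw hdN hlam β
  have hpt := lintegral_mono (μ := jobLaw N d lam β) fun x : Job N d =>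
    h.assign_le hc hv hw x.2.1 x.2.2
  have hmi : Measurable fun x : Job N d => invTail β c x.2.2 :=
    (measurable_invTail β c).comp (by fun_prop)
  rw [lintegral_add_left measurable_const, lintegral_const, measure_univ, mul_one,
    lintegral_add_right _ measurable_const, lintegral_const, measure_univ, mul_one,
    lintegral_add_right _ (hmi.const_mul _), lintegral_const_mul _ hmi,
    lintegral_jobLaw_requirements hdN hlam β (measurable_invTail β c),
    lintegral_jobLaw_requirements hdN hlam β (f := fun b => ENNReal.ofReal (minClamp c b))
      (by fun_prop),
    ← meanGrowth_succ hdN hlam] at hpt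
  -- The expected loss by lifting phases; it is finite and hence can be cancelled in `ℝ≥0∞`.
  set P : ℝ≥0∞ := g * (N * N ^ d * d * β (Set.Ioi 0)) with hP
  have hPt : P ≠ ∞ := by
    rw [hP]
    finiteness
  have h1 : ENNReal.ofReal v + g * (n + 1 : ℕ) + P ≤
      meanGrowth d lam β c (n + 1) w + ENNReal.ofReal c + P := by
    calc ENNReal.ofReal v + g * (n + 1 : ℕ) + P
        = ENNReal.ofReal v + g * n + g * (1 + N * N ^ d * d * β (Set.Ioi 0)) := by
          rw [hP]; push_cast; ring
      _ ≤ _ := add_le_add le_rfl hrate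
      _ ≤ _ := hpt
      _ ≤ meanGrowth d lam β c (n + 1) w + g * (N * N ^ d) * (d * β (Set.Ioi 0)) +
            ENNReal.ofReal c := by
          gcongr
          exact lintegral_invTail_le β c
      _ = _ := by rw [hP]; ring
  exact (ENNReal.add_le_add_iff_right hPt).1 h1

/-- Every replica of a lifting job ends at or above `v + y`: at `s j₀` because that server is
already lifted, elsewhere because its requirement is at least `y`. Hence `s j₁` joins `A` and one
`liftTime` is saved; any other job does no harm. -/
lemma GrowthBound.assign_le_of_lift [Nonempty (Fin d)] {lam : ℝ} {β : Measure ℝ} {c : ℝ}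
    (hc : 0 ≤ c) {g : ℝ≥0∞} {n : ℕ} (h : GrowthBound N d lam β c g n) {r : ℕ} {w : Workload N}
    {v y : ℝ} {A : Finset (Fin N)} (hv : 0 ≤ v) (hy : 0 ≤ y) (hyc : y ≤ c) (hw : ∀ i, v ≤ w i)
    (hA : A.Nonempty) (hwA : ∀ i ∈ A, v + y ≤ w i) (hr : N ≤ A.card + (r + 1))
    {s : Fin d → Fin N} {j₀ j₁ : Fin d} (h0 : s j₀ ∈ A) (h1 : s j₁ ∉ A) (x : Job N d) :
    ENNReal.ofReal (v + y) + g * n +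
        (liftingJobs s j₀ y).indicator (fun _ => g * liftTime N d β y) x ≤
      meanGrowth d lam β c n (assign w x.2.1 fun j => clamp c (x.2.2 j)) +
        (g * ((r + 1 : ℕ) * liftTime N d β y) + ENNReal.ofReal c) := by
  have hw' : ∀ i, v ≤ assign w x.2.1 (fun j => clamp c (x.2.2 j)) i := fun i =>
    (hw i).trans (le_assign _ _ _ i)
  have hwA' : ∀ i ∈ A, v + y ≤ assign w x.2.1 (fun j => clamp c (x.2.2 j)) i := fun i hi =>
    (hwA i hi).trans (le_assign _ _ _ i)
  by_cases hx : x ∈ liftingJobs s j₀ y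
  · rw [Set.indicator_of_mem hx]
    obtain ⟨-, hxs, hxb⟩ := hx
    have hxs : x.2.1 = s := hxs
    have hlift : ∀ j, v + y ≤ w (x.2.1 j) + clamp c (x.2.2 j) := by
      intro j
      by_cases hj : j = j₀
      · subst hj
        rw [hxs]
        linarith [hwA _ h0, clamp_nonneg hc (x.2.2 j)]
      · have : x.2.2 j ∈ if j = j₀ then Set.univ else Set.Ici y := hxb j trivial
        rw [if_neg hj] at this
        exact add_le_add (hw _) (le_clamp hyc this)
    have := h.2 r _ v y (insert (s j₁) A) hv hy hyc hw' (Finset.insert_nonempty _ _)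
      (fun i hi => ?_) (by rw [Finset.card_insert_of_notMem h1]; omega)
    · calc _ ≤ _ := add_le_add this le_rfl
        _ = _ := by push_cast; ring
    · rcases Finset.mem_insert.1 hi with rfl | hi
      · rw [← hxs]
        exact le_assign_of_mem hlift j₁
      · exact hwA' i hi
  · rw [Set.indicator_of_notMem hx, add_zero, ← add_assoc]
    exact h.2 (r + 1) _ v y A hv hy hyc hw' hA hwA' hr

lemma growthBound_succ (hd : 2 ≤ d) (hdN : d ≤ N) {lam : ℝ} (hlam : 0 < lam) (β : Measure ℝ)
    [IsProbabilityMeasure β] {c : ℝ} (hc : 0 ≤ c) {g : ℝ≥0∞} (hg0 : g ≠ 0) (hgt : g ≠ ∞)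
    (hrate : g * (1 + N * N ^ d * d * β (Set.Ioi 0)) ≤
      ∫⁻ b : Fin d → ℝ, ENNReal.ofReal (minClamp c b) ∂Measure.pi fun _ => β)
    {n : ℕ} (h : GrowthBound N d lam β c g n) : GrowthBound N d lam β c g (n + 1) := by
  have : Nonempty (Fin d) := ⟨⟨0, by omega⟩⟩
  have := isProbabilityMeasure_jobLaw hdN hlam β
  have hidle := growthBound_succ_idle hdN hlam β hc hgt hrate h
  refine ⟨hidle, fun r w v y A hv hy hyc hw hA hwA hr => ?_⟩
  -- Once every server is lifted, the phase is over and `v + y` is the new common level.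
  by_cases hAu : ∀ i, i ∈ A
  · refine (hidle w (v + y) (by linarith) fun i => hwA i (hAu i)).trans ?_
    gcongr
    exact le_self_add
  push Not at hAu
  obtain ⟨b, hb⟩ := hAu
  obtain ⟨a, ha⟩ := hA
  obtain _ | r := r
  · have := Finset.card_lt_univ_of_notMem hb
    rw [Fintype.card_fin] at this
    omega
  -- With an infinite lift time the right-hand side is infinite, since `g` and `r + 1` are nonzero.
  by_cases hθ : liftTime N d β y = ∞
  · rw [hθ, ENNReal.mul_top (by simp), ENNReal.mul_top hg0]
    simp
  have hj : (⟨0, by omega⟩ : Fin d) ≠ ⟨1, by omega⟩ := by simp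
  obtain ⟨s, hs, hs0, hs1⟩ := exists_injective_of_ne hdN hj (a := a) (b := b)
    (fun h => hb (h ▸ ha))
  have hpt := lintegral_mono (μ := jobLaw N d lam β)
    (h.assign_le_of_lift hc hv hy hyc hw ⟨a, ha⟩ hwA hr (hs0 ▸ ha) (hs1 ▸ hb))
  rw [lintegral_add_left measurable_const, lintegral_const, measure_univ, mul_one,
    lintegral_indicator_const (measurableSet_liftingJobs _ _ _),
    lintegral_add_right _ measurable_const, lintegral_const, measure_univ, mul_one,
    ← meanGrowth_succ hdN hlam, ← add_assoc] at hpt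
  refine le_trans ?_ hpt
  push_cast
  rw [mul_add, mul_one, ← add_assoc, mul_assoc]
  gcongr
  exact le_mul_of_one_le_right' (le_liftTime_mul hdN (by omega) hlam β hs _ hθ)

lemma meanGrowth_ge (hd : 2 ≤ d) (hdN : d ≤ N) {lam : ℝ} (hlam : 0 < lam) (β : Measure ℝ)
    [IsProbabilityMeasure β] {c : ℝ} (hc : 0 ≤ c) {g : ℝ≥0∞} (hg0 : g ≠ 0) (hgt : g ≠ ∞)
    (hrate : g * (1 + N * N ^ d * d * β (Set.Ioi 0)) ≤
      ∫⁻ b : Fin d → ℝ, ENNReal.ofReal (minClamp c b) ∂Measure.pi fun _ => β) (n : ℕ) :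
    g * n ≤ meanGrowth d lam β c n (0 : Workload N) + ENNReal.ofReal c := by
  have : Nonempty (Fin N) := ⟨⟨0, by omega⟩⟩
  have h : GrowthBound N d lam β c g n := by
    induction n with
    | zero => exact growthBound_zero hdN hlam β c g
    | succ n ih => exact growthBound_succ hd hdN hlam β hc hg0 hgt hrate ih
  simpa using h.1 0 0 le_rfl fun i => le_rfl

end GrowthRate

/-! ### Stationarity excludes a positive mean increment. -/

section Stationarity

open Filter Topology

/-- The least load may fail to be integrable under `π`, so it is truncated at `L`. The truncated
increment has nonpositive mean by invariance and is bounded by `M`; dominated convergence lets `L`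
tend to infinity. -/
lemma integral_le_zero_of_stationary {N : ℕ} [Nonempty (Fin N)] {Ω : Type*} [MeasurableSpace Ω]
    {J : Measure Ω} [IsProbabilityMeasure J] {π : Measure (Workload N)} [IsProbabilityMeasure π]
    (hπ : ∀ᵐ w ∂π, ∀ i, 0 ≤ w i) {f : Workload N × Ω → Workload N}
    (hf : (π.prod J).map f = π) {Y : Ω → ℝ} (hY : Measurable Y) {M : ℝ} (hM : ∀ x, |Y x| ≤ M)
    (hfY : ∀ᵐ p ∂π.prod J, leastLoad p.1 + Y p.2 ≤ leastLoad (f p)) : ∫ x, Y x ∂J ≤ 0 := by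
  -- Measurability comes for free: otherwise `Measure.map` would be `0`, not a probability measure.
  have hfm : AEMeasurable f (π.prod J) := by
    by_contra h
    rw [Measure.map_of_not_aemeasurable h] at hf
    exact IsProbabilityMeasure.ne_zero π hf.symm
  have hfst : ∀ᵐ p ∂π.prod J, 0 ≤ leastLoad p.1 :=
    Measure.quasiMeasurePreserving_fst.ae (hπ.mono fun w hw => le_leastLoad hw)
  have hπf : ∀ᵐ p ∂π.prod J, 0 ≤ leastLoad (f p) :=
    ae_of_ae_map hfm (p := fun w => 0 ≤ leastLoad w)
      (by rw [hf]; exact hπ.mono fun w hw => le_leastLoad hw)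
  have hbd : ∀ L : ℕ, ∀ z : ℝ, 0 ≤ z → ‖min z (L : ℝ)‖ ≤ L := fun L z hz => by
    rw [Real.norm_of_nonneg (le_min hz (Nat.cast_nonneg L))]
    exact min_le_right _ _
  have hint1 : ∀ L : ℕ, Integrable (fun p => min (leastLoad p.1) (L : ℝ)) (π.prod J) := fun L =>
    .of_bound (Measurable.aestronglyMeasurable (by fun_prop)) L (hfst.mono fun p hp => hbd L _ hp)
  have hint2 : ∀ L : ℕ, Integrable (fun p => min (leastLoad (f p)) (L : ℝ)) (π.prod J) := fun L =>
    .of_bound ((measurable_leastLoad.comp_aemeasurable hfm).min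
      aemeasurable_const).aestronglyMeasurable L (hπf.mono fun p hp => hbd L _ hp)
  have heq : ∀ L : ℕ, ∫ p, min (leastLoad (f p)) (L : ℝ) ∂π.prod J =
      ∫ p, min (leastLoad p.1) (L : ℝ) ∂π.prod J := by
    intro L
    have hm : Measurable fun w : Workload N => min (leastLoad w) (L : ℝ) := by fun_prop
    rw [← integral_map hfm hm.aestronglyMeasurable, hf,
      integral_fun_fst (fun w => min (leastLoad w) (L : ℝ))]
    simp
  have hlip : ∀ (L : ℕ) (p : Workload N × Ω),
      ‖min (leastLoad p.1 + Y p.2) (L : ℝ) - min (leastLoad p.1) L‖ ≤ M := by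
    intro L p
    refine (abs_min_sub_min_le_max _ _ _ _).trans (max_le ?_ ?_)
    · rw [add_sub_cancel_left]
      exact hM _
    · rw [sub_self, abs_zero]
      exact (abs_nonneg _).trans (hM p.2)
  have hYm : Measurable fun p : Workload N × Ω => Y p.2 := hY.comp measurable_snd
  have hle : ∀ L : ℕ,
      ∫ p, (min (leastLoad p.1 + Y p.2) (L : ℝ) - min (leastLoad p.1) L) ∂π.prod J ≤ 0 := by
    intro L
    have := integral_mono_ae (μ := π.prod J)
      (f := fun p => min (leastLoad p.1 + Y p.2) (L : ℝ) - min (leastLoad p.1) L)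
      (.of_bound (Measurable.aestronglyMeasurable (by fun_prop)) M (ae_of_all _ (hlip L))) ((hint2 L).sub (hint1 L))
      (hfY.mono fun p hp => sub_le_sub_right (min_le_min_right _ hp) _)
    refine this.trans (le_of_eq ?_)
    simp only [Pi.sub_apply]
    rw [integral_sub (hint2 L) (hint1 L), heq, sub_self]
  have hlim : Tendsto (fun L : ℕ =>
      ∫ p, (min (leastLoad p.1 + Y p.2) (L : ℝ) - min (leastLoad p.1) L) ∂π.prod J) atTop
      (𝓝 (∫ p, Y p.2 ∂π.prod J)) := by
    refine tendsto_integral_of_dominated_convergence (fun _ => M) (fun L => Measurable.aestronglyMeasurable (by fun_prop))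
      (integrable_const M) (fun L => ae_of_all _ (hlip L)) (ae_of_all _ fun p => ?_)
    obtain ⟨L₀, hL₀⟩ := exists_nat_ge (max (leastLoad p.1 + Y p.2) (leastLoad p.1))
    refine tendsto_const_nhds.congr' ?_
    filter_upwards [eventually_ge_atTop L₀] with L hL
    have hL' : (L₀ : ℝ) ≤ L := by exact_mod_cast hL
    rw [min_eq_left ((le_max_left _ _).trans (hL₀.trans hL')),
      min_eq_left ((le_max_right _ _).trans (hL₀.trans hL'))]
    ring
  have hfin := le_of_tendsto' hlim hle
  rw [integral_fun_snd] at hfin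
  simpa using hfin

end Stationarity

/-! ### Law of large numbers for the arrival times. -/

section Arrivals

open Filter Topology
open scoped ENNReal

lemma ae_nonneg_expMeasure (lam : ℝ) : ∀ᵐ x ∂expMeasure lam, 0 ≤ x := by
  rw [ae_iff]
  have : {x : ℝ | ¬0 ≤ x} = Set.Iio 0 := by ext; simp
  rw [this, expMeasure, gammaMeasure, withDensity_apply _ measurableSet_Iio]
  exact lintegral_gammaPDF_of_nonpos le_rfl

/-- Multiplying the exponential density by `x` gives `1 / lam` times the gamma density of shape `2`.
-/
lemma lintegral_id_expMeasure {lam : ℝ} (hlam : 0 < lam) :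
    ∫⁻ x, ENNReal.ofReal x ∂expMeasure lam = ENNReal.ofReal (1 / lam) := by
  have hm : ∀ a, Measurable (gammaPDF a lam) := fun a =>
    (measurable_gammaPDFReal a lam).ennreal_ofReal
  rw [expMeasure, gammaMeasure, lintegral_withDensity_eq_lintegral_mul _ (hm 1) (by fun_prop)]
  have h : ∀ x, (gammaPDF 1 lam * fun x => ENNReal.ofReal x) x =
      ENNReal.ofReal (1 / lam) * gammaPDF 2 lam x := by
    intro x
    rw [Pi.mul_apply]
    rcases lt_or_ge x 0 with hx | hx
    · simp [gammaPDF_of_neg hx]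
    · rw [gammaPDF_of_nonneg hx, gammaPDF_of_nonneg hx, ← ENNReal.ofReal_mul (by positivity),
        ← ENNReal.ofReal_mul (by positivity)]
      congr 1
      have h2 : Real.Gamma 2 = 1 := Real.Gamma_two
      have h3 : x ^ ((2 : ℝ) - 1) = x := by norm_num
      rw [h2, h3, Real.Gamma_one]
      have h4 : lam ^ (2 : ℝ) = lam * lam := by
        rw [show (2 : ℝ) = (2 : ℕ) by norm_num, Real.rpow_natCast, sq]
      rw [h4]
      simp only [sub_self, Real.rpow_zero, Real.rpow_one]
      field_simp
  simp_rw [h]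
  rw [lintegral_const_mul _ (hm 2), lintegral_gammaPDF_eq_one (by norm_num) hlam, mul_one]

lemma integrable_id_expMeasure {lam : ℝ} (hlam : 0 < lam) :
    Integrable (fun x : ℝ => x) (expMeasure lam) := by
  refine ⟨by fun_prop, ?_⟩
  rw [hasFiniteIntegral_iff_ofReal (ae_nonneg_expMeasure lam), lintegral_id_expMeasure hlam]
  exact ENNReal.ofReal_lt_top

lemma integral_id_expMeasure {lam : ℝ} (hlam : 0 < lam) :
    ∫ x, x ∂expMeasure lam = 1 / lam := by
  rw [integral_eq_lintegral_of_nonneg_ae (ae_nonneg_expMeasure lam) (by fun_prop),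
    lintegral_id_expMeasure hlam, ENNReal.toReal_ofReal (by positivity)]

variable {N d : ℕ}

lemma tendsto_arrivalTime_div (hdN : d ≤ N) {lam : ℝ} (hlam : 0 < lam) (β : Measure ℝ)
    [IsProbabilityMeasure β] : ∀ᵐ jobs ∂jobsLaw N d lam β,
      Tendsto (fun n : ℕ => arrivalTime jobs n / n) atTop (𝓝 (1 / lam)) := by
  have := isProbabilityMeasure_expMeasure hlam
  have := isProbabilityMeasure_uniformOn_injective hdN
  have := isProbabilityMeasure_jobLaw hdN hlam β
  have hev : ∀ n : ℕ, MeasurePreserving (fun jobs : ℕ → Job N d => (jobs n).1)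
      (jobsLaw N d lam β) (expMeasure lam) := fun n =>
    measurePreserving_fst.comp (measurePreserving_eval_infinitePi (fun _ => jobLaw N d lam β) n)
  have hint : Integrable (fun jobs : ℕ → Job N d => (jobs 0).1) (jobsLaw N d lam β) :=
    (hev 0).integrable_comp_of_integrable (integrable_id_expMeasure hlam)
  have hmean : ∫ jobs : ℕ → Job N d, (jobs 0).1 ∂jobsLaw N d lam β = 1 / lam := by
    rw [← integral_id_expMeasure hlam, ← (hev 0).map_eq,
      integral_map (hev 0).measurable.aemeasurable (by fun_prop)]
  have hind : iIndepFun (fun (n : ℕ) (jobs : ℕ → Job N d) => (jobs n).1) (jobsLaw N d lam β) :=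
    iIndepFun_infinitePi (X := fun (_ : ℕ) (x : Job N d) => x.1) fun _ => measurable_fst
  have := strong_law_ae_real (fun (n : ℕ) (jobs : ℕ → Job N d) => (jobs n).1) hint
    (fun i j hij => hind.indepFun hij)
    (fun n => ⟨(hev n).measurable.aemeasurable, (hev 0).measurable.aemeasurable,
      (hev n).map_eq.trans (hev 0).map_eq.symm⟩)
  rw [hmean] at this
  exact this

@[fun_prop]
lemma measurable_arrivalTime (n : ℕ) :
    Measurable fun jobs : ℕ → Job N d => arrivalTime jobs n := by
  unfold arrivalTime
  fun_prop

lemma tendsto_measure_arrivalTime_gt (hdN : d ≤ N) {lam : ℝ} (hlam : 0 < lam) (β : Measure ℝ)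
    [IsProbabilityMeasure β] {θ : ℝ} (hθ : 1 / lam < θ) :
    Tendsto (fun n : ℕ => (jobsLaw N d lam β).real {jobs | n * θ < arrivalTime jobs n}) atTop
      (𝓝 0) := by
  have := isProbabilityMeasure_jobsLaw hdN hlam β
  have h := tendstoInMeasure_of_tendsto_ae (fun n : ℕ =>
    ((measurable_arrivalTime (N := N) (d := d) n).div_const (n : ℝ)).aestronglyMeasurable)
    (tendsto_arrivalTime_div hdN hlam β)
  rw [tendstoInMeasure_iff_measureReal_norm] at h
  refine squeeze_zero' (Eventually.of_forall fun n => measureReal_nonneg) ?_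
    (h (θ - 1 / lam) (by linarith))
  filter_upwards [eventually_gt_atTop 0] with n hn
  refine measureReal_mono fun jobs hj => ?_
  have hn' : (0 : ℝ) < n := by exact_mod_cast hn
  have h1 : θ < arrivalTime jobs n / n := by
    rw [lt_div_iff₀ hn', mul_comm]
    exact hj
  exact (sub_le_sub_right h1.le _).trans (le_abs_self _)

lemma finite_arrivals {jobs : ℕ → Job N d} {a : ℝ} (ha : 0 < a)
    (h : Tendsto (fun n : ℕ => arrivalTime jobs n / n) atTop (𝓝 a)) (t : ℝ) :
    {n : ℕ | arrivalTime jobs (n + 1) ≤ t}.Finite := by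
  have h1 : Tendsto (fun n : ℕ => arrivalTime jobs n) atTop atTop := by
    refine (h.pos_mul_atTop ha tendsto_natCast_atTop_atTop).congr' ?_
    filter_upwards [eventually_gt_atTop 0] with n hn
    have hn' : (n : ℝ) ≠ 0 := by exact_mod_cast hn.ne'
    field_simp
  have h2 := ((tendsto_add_atTop_iff_nat 1).2 h1).eventually_gt_atTop t
  rw [← Nat.cofinite_eq_atTop] at h2
  refine h2.subset fun n hn => ?_
  simpa using hn

lemma ae_jobs_nonneg (hdN : d ≤ N) {lam : ℝ} (hlam : 0 < lam) (β : Measure ℝ)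
    [IsProbabilityMeasure β] (hβ : ∀ᵐ x ∂β, 0 ≤ x) :
    ∀ᵐ jobs ∂jobsLaw N d lam β, ∀ n, 0 ≤ (jobs n).1 ∧ ∀ j, 0 ≤ (jobs n).2.2 j := by
  have := isProbabilityMeasure_expMeasure hlam
  have := isProbabilityMeasure_uniformOn_injective hdN
  have := isProbabilityMeasure_jobLaw hdN hlam β
  have hjob : ∀ᵐ x ∂jobLaw N d lam β, 0 ≤ x.1 ∧ ∀ j, 0 ≤ x.2.2 j := by
    refine (Measure.quasiMeasurePreserving_fst.ae (ae_nonneg_expMeasure lam)).and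
      (ae_all_iff.2 fun j => ?_)
    exact Measure.quasiMeasurePreserving_snd.ae (Measure.quasiMeasurePreserving_snd.ae
      ((Measure.quasiMeasurePreserving_eval (μ := fun _ : Fin d => β) j).ae hβ))
  exact ae_all_iff.2 fun n => (measurePreserving_eval_infinitePi
    (fun _ => jobLaw N d lam β) n).quasiMeasurePreserving.ae hjob

end Arrivals

/-! ### Mean minimum of scaled Bernoulli requirements. -/

section ScaledBernoulli

open scoped ENNReal

lemma isProbabilityMeasure_scaledBernoulli (ν : Measure ℝ) [IsProbabilityMeasure ν] {K : ℝ}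
    (hK : 1 ≤ K) : IsProbabilityMeasure (scaledBernoulli ν K) := by
  have h1 : 1 / K ≤ 1 := (div_le_one (by linarith)).2 hK
  have h0 : 0 ≤ 1 / K := by positivity
  constructor
  rw [scaledBernoulli, Measure.add_apply, Measure.smul_apply, Measure.smul_apply,
    Measure.map_apply (by fun_prop) .univ, Set.preimage_univ, measure_univ, measure_univ,
    smul_eq_mul, smul_eq_mul, mul_one, mul_one, ← ENNReal.ofReal_add h0 (by linarith)]
  simp

lemma ae_nonneg_scaledBernoulli {ν : Measure ℝ} (hν : ∀ᵐ x ∂ν, 0 < x) {K : ℝ} (hK : 0 ≤ K) :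
    ∀ᵐ x ∂scaledBernoulli ν K, 0 ≤ x := by
  rw [scaledBernoulli, ae_add_measure_iff]
  refine ⟨Measure.ae_smul_measure ?_ _, Measure.ae_smul_measure ?_ _⟩
  · rw [ae_map_iff (by fun_prop) measurableSet_Ici]
    exact hν.mono fun x hx => mul_nonneg hx.le hK
  · rw [ae_dirac_iff measurableSet_Ici]

lemma scaledBernoulli_apply (ν : Measure ℝ) (K : ℝ) {s : Set ℝ} (hs : MeasurableSet s)
    (h0 : (0 : ℝ) ∉ s) :
    scaledBernoulli ν K s = ENNReal.ofReal (1 / K) * ν {x | x * K ∈ s} := by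
  rw [scaledBernoulli, Measure.add_apply, Measure.smul_apply, Measure.smul_apply,
    Measure.map_apply (by fun_prop) hs, Measure.dirac_apply' _ hs, Set.indicator_of_notMem h0]
  simp [Set.preimage]

lemma scaledBernoulli_Ioi_le (ν : Measure ℝ) [IsProbabilityMeasure ν] (K : ℝ) :
    scaledBernoulli ν K (Set.Ioi 0) ≤ ENNReal.ofReal (1 / K) := by
  rw [scaledBernoulli_apply ν K measurableSet_Ioi (by simp)]
  exact mul_le_of_le_one_right' prob_le_one

lemma lintegral_iInf_pi {d : ℕ} [Nonempty (Fin d)] (μ : Measure ℝ) [IsProbabilityMeasure μ]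
    {f : ℝ → ℝ} (hf : Measurable f) (hf0 : ∀ᵐ x ∂μ, 0 ≤ f x) :
    ∫⁻ x : Fin d → ℝ, ENNReal.ofReal (⨅ j, f (x j)) ∂Measure.pi (fun _ => μ) =
      ∫⁻ t in Set.Ioi 0, μ {x | t ≤ f x} ^ d := by
  have h0 : ∀ᵐ x ∂Measure.pi (fun _ : Fin d => μ), 0 ≤ ⨅ j, f (x j) := by
    have : ∀ᵐ x ∂Measure.pi (fun _ : Fin d => μ), ∀ j, 0 ≤ f (x j) := ae_all_iff.2 fun j =>
      (Measure.quasiMeasurePreserving_eval (μ := fun _ : Fin d => μ) j).ae hf0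
    exact this.mono fun x hx => le_ciInf hx
  rw [lintegral_eq_lintegral_meas_le _ h0
    (Measurable.iInf fun j => hf.comp (measurable_pi_apply j)).aemeasurable]
  refine lintegral_congr fun t => ?_
  have hset : {x : Fin d → ℝ | t ≤ ⨅ j, f (x j)} = Set.univ.pi fun _ => {x | t ≤ f x} := by
    ext x
    simp only [Set.mem_ofPred_eq, Set.mem_univ_pi]
    exact le_ciInf_iff (Set.finite_range _).bddBelow
  rw [hset, Measure.pi_pi]
  simp

/-- By the layer cake formula the mean is the integral of the `d`-th power of the tail over `t > 0`,
where the atom at `0` is invisible and the tail is `1 / K` times that of `X * K`. -/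
lemma lintegral_iInf_scaledBernoulli {d : ℕ} [Nonempty (Fin d)] {ν : Measure ℝ}
    [IsProbabilityMeasure ν] (hν : ∀ᵐ x ∂ν, 0 < x) {K : ℝ} (hK : 1 ≤ K) :
    ∫⁻ b : Fin d → ℝ, ENNReal.ofReal (⨅ j, b j) ∂Measure.pi (fun _ => scaledBernoulli ν K) =
      ENNReal.ofReal (1 / K) ^ d * (ENNReal.ofReal K *
        ∫⁻ x : Fin d → ℝ, ENNReal.ofReal (⨅ j, x j) ∂Measure.pi fun _ => ν) := by
  have hK0 : 0 ≤ K := by linarith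
  have := isProbabilityMeasure_scaledBernoulli ν hK
  have hscale : ∀ x : Fin d → ℝ, ENNReal.ofReal K * ENNReal.ofReal (⨅ j, x j) =
      ENNReal.ofReal (⨅ j, x j * K) := fun x => by
    rw [← ENNReal.ofReal_mul hK0, mul_comm, Real.iInf_mul_of_nonneg hK0]
  have hm : Measurable fun t => ν {x | t ≤ x * K} :=
    Antitone.measurable fun _ _ h => measure_mono fun _ hx => h.trans hx
  rw [← lintegral_const_mul _
      (Measurable.iInf fun j => measurable_pi_apply j).ennreal_ofReal]
  simp_rw [hscale]
  rw [lintegral_iInf_pi ν (f := fun x => x * K) (by fun_prop)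
      (hν.mono fun x hx => mul_nonneg hx.le hK0),
    lintegral_iInf_pi (scaledBernoulli ν K) (f := fun x => x) measurable_id
      (ae_nonneg_scaledBernoulli hν hK0), ← lintegral_const_mul _ (hm.pow_const d)]
  refine setLIntegral_congr_fun measurableSet_Ioi fun t ht => ?_
  rw [← mul_pow]
  congr 1
  have h0 : (0 : ℝ) ∉ Set.Ici t := fun h => not_lt_of_ge h (Set.mem_Ioi.1 ht)
  exact scaledBernoulli_apply ν K measurableSet_Ici h0

lemma expectedMin_nonneg {d : ℕ} [Nonempty (Fin d)] {ν : Measure ℝ} [IsProbabilityMeasure ν]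
    (hν : ∀ᵐ x ∂ν, 0 < x) : 0 ≤ᵐ[Measure.pi fun _ : Fin d => ν] fun x => ⨅ j, x j := by
  have : ∀ᵐ x ∂Measure.pi (fun _ : Fin d => ν), ∀ j, 0 < x j := ae_all_iff.2 fun j =>
    (Measure.quasiMeasurePreserving_eval (μ := fun _ : Fin d => ν) j).ae hν
  exact this.mono fun x hx => le_ciInf fun j => (hx j).le

lemma ofReal_expectedMin_le {d : ℕ} [Nonempty (Fin d)] {ν : Measure ℝ} [IsProbabilityMeasure ν]
    (hν : ∀ᵐ x ∂ν, 0 < x) : ENNReal.ofReal (expectedMin d ν) ≤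
      ∫⁻ x : Fin d → ℝ, ENNReal.ofReal (⨅ j, x j) ∂Measure.pi fun _ => ν := by
  rw [expectedMin, integral_eq_lintegral_of_nonneg_ae (expectedMin_nonneg hν)
    (Measurable.iInf fun j => measurable_pi_apply j).aestronglyMeasurable]
  exact ENNReal.ofReal_toReal_le

/-- Monotone convergence: a strict lower bound for the mean minimum survives clamping at a high
level. -/
lemma exists_lt_lintegral_minClamp {d : ℕ} [Nonempty (Fin d)] (β : Measure ℝ) {a : ℝ≥0∞}
    (ha : a < ∫⁻ b : Fin d → ℝ, ENNReal.ofReal (⨅ j, b j) ∂Measure.pi fun _ => β) :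
    ∃ k : ℕ, a < ∫⁻ b : Fin d → ℝ, ENNReal.ofReal (minClamp k b) ∂Measure.pi fun _ => β := by
  rw [← lt_iSup_iff, ← lintegral_iSup (fun k => by fun_prop)]
  · refine ha.trans_le (lintegral_mono fun b => ?_)
    obtain ⟨k, hk⟩ := exists_nat_ge (∑ j, |b j|)
    refine le_trans (ENNReal.ofReal_le_ofReal ?_)
      (le_iSup (fun k : ℕ => ENNReal.ofReal (minClamp k b)) k)
    refine le_ciInf fun j => (ciInf_le (Set.finite_range b).bddBelow j).trans
      (le_clamp ((le_abs_self _).trans (le_trans ?_ hk)) le_rfl)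
    exact Finset.single_le_sum (f := fun j => |b j|) (fun _ _ => abs_nonneg _) (Finset.mem_univ j)
  · intro k l hkl b
    refine ENNReal.ofReal_le_ofReal (le_ciInf fun j => (minClamp_le _ b j).trans ?_)
    exact min_le_min le_rfl (by exact_mod_cast hkl)

end ScaledBernoulli

/-! ### Positive drift and the final estimate. -/

section Instability

open Filter Topology
open scoped ENNReal

variable {N d : ℕ}

lemma integral_leastLoad_growth_ge (hd : 2 ≤ d) (hdN : d ≤ N) {lam : ℝ} (hlam : 0 < lam)
    (β : Measure ℝ) [IsProbabilityMeasure β] {c : ℝ} (hc : 0 ≤ c) {γ : ℝ} (hγ : 0 < γ)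
    (hrate : ENNReal.ofReal γ * (1 + N * N ^ d * d * β (Set.Ioi 0)) ≤
      ∫⁻ b : Fin d → ℝ, ENNReal.ofReal (minClamp c b) ∂Measure.pi fun _ => β) (n : ℕ) :
    Integrable (fun jobs : ℕ → Job N d => leastLoad (growth c 0 jobs n)) (jobsLaw N d lam β) ∧
      γ * n ≤ ∫ jobs : ℕ → Job N d, leastLoad (growth c 0 jobs n) ∂jobsLaw N d lam β + c := by
  have : Nonempty (Fin d) := ⟨⟨0, by omega⟩⟩
  have : Nonempty (Fin N) := ⟨⟨0, by omega⟩⟩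
  have := isProbabilityMeasure_jobsLaw hdN hlam β
  have hm : Measurable fun jobs : ℕ → Job N d => leastLoad (growth c 0 jobs n) :=
    measurable_leastLoad.comp ((measurable_growth c n).comp measurable_prodMk_left)
  have h0 : ∀ jobs : ℕ → Job N d, 0 ≤ leastLoad (growth c 0 jobs n) := fun jobs =>
    le_leastLoad fun i => growth_mono c 0 jobs (Nat.zero_le n) i
  have hint : Integrable (fun jobs : ℕ → Job N d => leastLoad (growth c 0 jobs n))
      (jobsLaw N d lam β) := by
    refine .of_bound hm.aestronglyMeasurable (n * c) (ae_of_all _ fun jobs => ?_)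
    rw [Real.norm_of_nonneg (h0 jobs)]
    exact (leastLoad_le _ (Classical.arbitrary _)).trans (growth_le hc jobs n _)
  refine ⟨hint, ?_⟩
  have h := meanGrowth_ge hd hdN hlam β hc (by simpa using hγ) ENNReal.ofReal_ne_top hrate n
  have hi0 : 0 ≤ ∫ jobs : ℕ → Job N d, leastLoad (growth c 0 jobs n) ∂jobsLaw N d lam β :=
    integral_nonneg h0
  rw [meanGrowth, ← ofReal_integral_eq_lintegral_ofReal hint (ae_of_all _ h0),
    ← ENNReal.ofReal_add hi0 hc, ← ENNReal.ofReal_natCast, ← ENNReal.ofReal_mul hγ.le] at h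
  exact (ENNReal.ofReal_le_ofReal_iff (by positivity)).1 h

lemma not_stable_of_growth_rate (hd : 2 ≤ d) (hdN : d ≤ N) {lam : ℝ} (hlam : 0 < lam)
    (β : Measure ℝ) [IsProbabilityMeasure β] (hβ : ∀ᵐ x ∂β, 0 ≤ x) {c : ℝ} (hc : 0 ≤ c) {γ : ℝ}
    (hγ : 1 / lam < γ) (hrate : ENNReal.ofReal γ * (1 + N * N ^ d * d * β (Set.Ioi 0)) ≤
      ∫⁻ b : Fin d → ℝ, ENNReal.ofReal (minClamp c b) ∂Measure.pi fun _ => β) :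
    ¬Stable N d lam β := by
  rintro ⟨π, hπ, hπ0, hstat⟩
  have : Nonempty (Fin d) := ⟨⟨0, by omega⟩⟩
  have : Nonempty (Fin N) := ⟨⟨0, by omega⟩⟩
  have := isProbabilityMeasure_jobsLaw hdN hlam β
  have hlam' : 0 < 1 / lam := by positivity
  -- The system is observed at time `n * θ`. As `1 / lam < θ`, the `n`-th job has then very likely
  -- arrived; as `θ < γ`, the growth exceeds the elapsed time. Half of `n * (γ - θ)` absorbs late
  -- arrivals, the other half the additive `c`.
  obtain ⟨θ, hθ1, hθ2⟩ := exists_between hγ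
  have hsmall : ∀ᶠ n : ℕ in atTop,
      (jobsLaw N d lam β).real {jobs | n * θ < arrivalTime jobs n} * c < (γ - θ) / 2 := by
    have := (tendsto_measure_arrivalTime_gt hdN hlam β hθ1).mul_const c
    rw [zero_mul] at this
    exact this.eventually_lt_const (by linarith)
  have hlarge : ∀ᶠ n : ℕ in atTop, c < n * ((γ - θ) / 2) :=
    (tendsto_natCast_atTop_atTop.atTop_mul_const (by linarith)).eventually_gt_atTop c
  obtain ⟨n, hn1, hn2⟩ := (hsmall.and hlarge).exists
  set S : Set (ℕ → Job N d) := {jobs | n * θ < arrivalTime jobs n} with hS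
  have hSm : MeasurableSet S := measurableSet_lt measurable_const (measurable_arrivalTime n)
  set Y : (ℕ → Job N d) → ℝ := fun jobs =>
    leastLoad (growth c 0 jobs n) - S.indicator (fun _ => n * c) jobs - n * θ with hY
  obtain ⟨hint, hge⟩ :=
    integral_leastLoad_growth_ge hd hdN hlam β hc (hlam'.trans hγ) hrate n
  have hm : Measurable fun jobs : ℕ → Job N d => leastLoad (growth c 0 jobs n) :=
    measurable_leastLoad.comp ((measurable_growth c n).comp measurable_prodMk_left)
  have hYm : Measurable Y := (hm.sub (measurable_const.indicator hSm)).sub_const _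
  have hnc : 0 ≤ (n : ℝ) * c := by positivity
  have hnθ : 0 ≤ (n : ℝ) * θ := mul_nonneg (Nat.cast_nonneg n) (by linarith)
  have hYb : ∀ jobs, |Y jobs| ≤ n * c + n * θ := by
    intro jobs
    have h1 : 0 ≤ leastLoad (growth c 0 jobs n) :=
      le_leastLoad fun i => growth_mono c 0 jobs (Nat.zero_le n) i
    have h2 : leastLoad (growth c 0 jobs n) ≤ n * c :=
      (leastLoad_le _ (Classical.arbitrary _)).trans (growth_le hc jobs n _)
    have h3 : 0 ≤ S.indicator (fun _ => (n : ℝ) * c) jobs :=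
      Set.indicator_nonneg (fun _ _ => hnc) _
    have h4 : S.indicator (fun _ => (n : ℝ) * c) jobs ≤ n * c :=
      Set.indicator_le_self' (fun _ _ => hnc) _
    rw [abs_le]
    constructor <;> simp only [hY] <;> linarith
  have hpath : ∀ᵐ jobs ∂jobsLaw N d lam β, ∀ w : Workload N,
      leastLoad w + Y jobs ≤ leastLoad (workload w jobs (n * θ)) := by
    filter_upwards [ae_jobs_nonneg hdN hlam β hβ, tendsto_arrivalTime_div hdN hlam β]
      with jobs h1 h2 w
    exact leastLoad_workload_ge hc w (fun k => (h1 k).1) (fun k => (h1 k).2)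
      (finite_arrivals hlam' h2 _) n
  have hle := integral_le_zero_of_stationary hπ0 (hstat (n * θ) hnθ) hYm hYb
    (Measure.quasiMeasurePreserving_snd.ae (hpath.mono fun jobs h => h) |>.mono
      fun p h => h p.1)
  have hind : Integrable (S.indicator fun _ => (n : ℝ) * c) (jobsLaw N d lam β) :=
    (integrable_const _).indicator hSm
  have hsub : Integrable (fun jobs : ℕ → Job N d => leastLoad (growth c 0 jobs n) -
      S.indicator (fun _ => (n : ℝ) * c) jobs) (jobsLaw N d lam β) := hint.sub hind
  have heq : ∫ jobs, Y jobs ∂jobsLaw N d lam β =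
      ∫ jobs : ℕ → Job N d, leastLoad (growth c 0 jobs n) ∂jobsLaw N d lam β -
        (jobsLaw N d lam β).real S * (n * c) - n * θ := by
    simp only [hY]
    rw [integral_sub hsub (integrable_const _), integral_sub hint hind,
      integral_indicator_const _ hSm]
    simp
  rw [heq] at hle
  have hmul : (n : ℝ) * ((jobsLaw N d lam β).real S * c) ≤ n * ((γ - θ) / 2) :=
    mul_le_mul_of_nonneg_left hn1.le (Nat.cast_nonneg n)
  nlinarith

end Instability

/-- In `N * N ^ d * d` the factors count the servers to be lifted, bound the ordered samples, and
count the candidates for the smallest requirement. Divided by `K`, which bounds the probability of a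
positive requirement, this is the relative loss of growth. -/
lemma one_sub_mul_load_lt_one {N d : ℕ} (hd : 2 ≤ d) (hdN : d ≤ N) {ε : ℝ} (hε : 0 < ε) {K : ℝ}
    (hK : max 1 ((N : ℝ) * N ^ d * d / ε) < K) {ν : Measure ℝ} [IsProbabilityMeasure ν]
    (hν : ∀ᵐ x ∂ν, 0 < x) {lam : ℝ} (hlam : 0 < lam)
    (hst : Stable N d lam (scaledBernoulli ν K)) :
    (1 - ε) * (lam * expectedMin d ν / K ^ (d - 1)) < 1 := by
  have : Nonempty (Fin d) := ⟨⟨0, by omega⟩⟩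
  have hK1 : 1 < K := (le_max_left _ _).trans_lt hK
  have hK0 : 0 < K := by linarith
  have := isProbabilityMeasure_scaledBernoulli ν hK1.le
  set C : ℝ := (N : ℝ) * N ^ d * d with hC
  have hC0 : 0 ≤ C := by positivity
  have hCK : C / K < ε := by
    have := (le_max_right _ _).trans_lt hK
    rw [div_lt_iff₀ hε] at this
    rw [div_lt_iff₀ hK0]
    linarith
  have hCK0 : 0 ≤ C / K := by positivity
  set e := expectedMin d ν / K ^ (d - 1) with he
  have he0 : 0 ≤ e := div_nonneg (integral_nonneg_of_ae (expectedMin_nonneg hν)) (by positivity)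
  by_contra hcon
  rw [mul_div_assoc, ← he, not_lt] at hcon
  -- Since `C / K < ε`, one has `(1 - ε) * (1 + C / K) < (1 - ε) * (1 + ε) < 1`.
  have hload : 1 + C / K < lam * e := by
    have hle : 0 ≤ lam * e := by positivity
    have h1 : 0 < 1 - ε := by
      by_contra h
      have := mul_nonpos_of_nonpos_of_nonneg (not_lt.1 h) hle
      linarith
    by_contra h
    have h2 := mul_le_mul_of_nonneg_left (not_lt.1 h) h1.le
    have h3 := mul_lt_mul_of_pos_left hCK h1
    nlinarith
  have hγ : 1 / lam < e / (1 + C / K) := by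
    rw [div_lt_div_iff₀ hlam (by linarith)]
    linarith
  -- The lower gap gives positive drift, the upper gap leaves room for clamping.
  obtain ⟨γ, hγ1, hγ2⟩ := exists_between hγ
  have hγ0 : 0 < γ := lt_trans (by positivity) hγ1
  rw [lt_div_iff₀ (by linarith)] at hγ2
  have hmean : ENNReal.ofReal (γ * (1 + C / K)) < ∫⁻ b : Fin d → ℝ, ENNReal.ofReal (⨅ j, b j)
      ∂Measure.pi (fun _ => scaledBernoulli ν K) := by
    rw [lintegral_iInf_scaledBernoulli hν hK1.le]
    refine lt_of_lt_of_le ((ENNReal.ofReal_lt_ofReal_iff (lt_trans (by positivity) hγ2)).2 hγ2)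
      (le_trans (le_of_eq ?_) (mul_le_mul_right (mul_le_mul_right (ofReal_expectedMin_le hν) _) _))
    rw [← ENNReal.ofReal_pow (by positivity), ← ENNReal.ofReal_mul hK0.le,
      ← ENNReal.ofReal_mul (by positivity)]
    congr 1
    obtain ⟨m, rfl⟩ : ∃ m, d = m + 1 := ⟨d - 1, by omega⟩
    rw [he, Nat.add_sub_cancel, pow_succ, one_div_pow]
    field_simp
  obtain ⟨k, hk⟩ := exists_lt_lintegral_minClamp _ hmean
  refine not_stable_of_growth_rate hd hdN hlam _ (ae_nonneg_scaledBernoulli hν hK0.le)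
    (Nat.cast_nonneg k) hγ1 (le_trans ?_ hk.le) hst
  rw [ENNReal.ofReal_mul hγ0.le, ENNReal.ofReal_add zero_le_one hCK0, ENNReal.ofReal_one]
  gcongr
  refine (mul_le_mul_right (scaledBernoulli_Ioi_le ν K) _).trans (le_of_eq ?_)
  rw [div_eq_mul_one_div C K, ENNReal.ofReal_mul hC0, hC, ENNReal.ofReal_mul (by positivity),
    ENNReal.ofReal_mul (by positivity), ENNReal.ofReal_pow (by positivity)]
  simp only [ENNReal.ofReal_natCast]

end

end COCRedundancy

theorem mainTheorem1 (N d : ℕ) (hd : 2 ≤ d) (hdN : d ≤ N) (ε : ℝ) (hε : 0 < ε) :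
    ∃ K₀ : ℝ, 1 ≤ K₀ ∧ ∀ K : ℝ, K₀ < K →
      ∀ ν : Measure ℝ, IsProbabilityMeasure ν → (∀ᵐ x ∂ν, 0 < x) →
        Integrable (fun x : ℝ => x) ν → ∫ x, x ∂ν = 1 →
      ∀ lam : ℝ, 0 < lam →
        COCRedundancy.Stable N d lam (COCRedundancy.scaledBernoulli ν K) →
        (1 - ε) * (lam * COCRedundancy.expectedMin d ν / K ^ (d - 1)) < 1 :=
  ⟨max 1 ((N : ℝ) * N ^ d * d / ε), le_max_left _ _, fun _ hK _ _ hν _ _ _ hlam hst =>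
    COCRedundancy.one_sub_mul_load_lt_one hd hdN hε hK hν hlam hst⟩
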